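/- **PAC-Bayes bound on coverage of ICP prediction sets.** Let $\mathcal{D}$ be a probability distribution on $\mathcal{X}\times\mathcal{Y}$, let $s(x,y;\theta)\in\mathbb{R}$ be a (jointly measurable) nonconformity score with parameter $\theta\in\Theta$, and let $P$ be a fixed (data-independent) prior probability distribution on $\Theta$. Assume that for $P$-almost every $\theta$ the distribution of $s(x,y;\theta)$ under $(x,y)\sim\mathcal{D}$ has no atoms. For a data set $D_N=((x_1,y_1),\dots,(x_N,y_N))$ and $\hat\alpha\in(0,1)$ let $\tau^*(D_N,\hat\alpha;\theta)$ be the $\lceil (N+1)(1-\hat\alpha)\rceil/N$ empirical quantile of the scores $s(x_i,y_i;\theta)$, $i=1,\dots,N$, let $C(x;\tau,\theta)=\{y\in\mathcal{Y} : s(x,y;\theta)\le\tau\}$, and for a probability distribution $Q$ on $\Theta$ let $$\mathcal{L}_{\mathrm{cov}}(Q)=\mathbb{E}_{\theta\sim Q}\Big[\Pr_{(x,y)\sim\mathcal{D}}\big[y\notin C(x;\tau^*(D_N,\hat\alpha;\theta),\theta)\big]\Big].$$ Let $\mathrm{kl}(p\,\|\,q)\in[0,\infty]$ be the KL divergence between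 Bernoulli distributions with success probabilities $p$ and $q$. For $N\ge 2$ put $k=\lfloor (N+1)\hat\alpha\rfloor$ and $$B(N)=\mathrm{Beta}\Big(\tfrac{k-1}{N-1};\,k,\,N+1-k\Big),\qquad \mathrm{Beta}(x;a,b)=\frac{\Gamma(a+b)}{\Gamma(a)\Gamma(b)}\,x^{a-1}(1-x)^{b-1}\quad (0\le x\le 1,\ 0^0=1).$$ (i) For every $N\ge 2$, every $\hat\alpha\in(0,1)$ with $N>1/\hat\alpha-1$, and every $\delta>0$: with probability greater than $1-\delta$ over the draw of $N$ i.i.d. samples $D_N\sim\mathcal{D}^N$, simultaneously for all probability distributions $Q$ on $\Theta$ (including those depending on $D_N$), $$\mathrm{kl}\left(\frac{\lfloor (N+1)\hat\alpha\rfloor-1}{N-1}\,\Big\|\,\mathcal{L}_{\mathrm{cov}}(Q)\right)\le\frac{\mathrm{KL}(Q\|P)+\log\big(B(N)/\delta\big)}{N-1}.$$ (ii) $B(N)=O\big(\sqrt{N/(\hat\alpha(1-\hat\alpha))}\big)$: there is a universal constant $c>0$ such that $B(N)\le c\sqrt{N/(\hat\alpha(1-\hat\alpha))}$ for all $N\ge2$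 and all $\hat\alpha\in(0,1)$ with $N>1/\hat\alpha-1$. -/

import Mathlib

open MeasureTheory ProbabilityTheory InformationTheory
open scoped ENNReal

namespace PACBayesICP

noncomputable section

/-- The prediction set `C(x; τ, θ) = {y | s(x, y; θ) ≤ τ}`. -/
def predictionSet {X Y Θ : Type*} (s : X → Y → Θ → ℝ) (τ : ℝ) (θ : Θ) (x : X) : Set Y :=
  {y | s x y θ ≤ τ}

/-- The empirical `q`-quantile of `v 0, …, v (N-1)`: the least real `t` such that at least a
fraction `q` of the values are `≤ t` (for `0 < q ≤ 1`). -/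
def empiricalQuantile {N : ℕ} (v : Fin N → ℝ) (q : ℝ) : ℝ :=
  sInf {t : ℝ | q ≤ ((Finset.univ.filter (fun i => v i ≤ t)).card : ℝ) / (N : ℝ)}

/-- The calibrated threshold `τ*(d, α; θ)`: the `⌈(N+1)(1-α)⌉ / N` quantile of the scores of the
calibration data `d`. -/
def threshold {X Y Θ : Type*} (s : X → Y → Θ → ℝ) {N : ℕ} (d : Fin N → X × Y) (α : ℝ)
    (θ : Θ) : ℝ :=
  empiricalQuantile (fun i => s (d i).1 (d i).2 θ) ((⌈((N : ℝ) + 1) * (1 - α)⌉₊ : ℝ) / (N : ℝ))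

/-- The test miscoverage, for `(x, y) ∼ D`, of the prediction set with parameter `θ` calibrated
on the data `d`. -/
def miscoverage {X Y Θ : Type*} [MeasurableSpace X] [MeasurableSpace Y] (D : Measure (X × Y))
    (s : X → Y → Θ → ℝ) {N : ℕ} (d : Fin N → X × Y) (α : ℝ) (θ : Θ) : ℝ :=
  D.real {z | z.2 ∉ predictionSet s (threshold s d α θ) θ z.1}

/-- The miscoverage `L_cov(Q)` of the randomized prediction set, `θ ∼ Q`. -/
def randomizedMiscoverage {X Y Θ : Type*} [MeasurableSpace X] [MeasurableSpace Y]
    [MeasurableSpace Θ] (D : Measure (X × Y)) (s : X → Y → Θ → ℝ) {N : ℕ} (d : Fin N → X × Y)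
    (α : ℝ) (Q : Measure Θ) : ℝ :=
  ∫ θ, miscoverage D s d α θ ∂Q

/-- The Bernoulli distribution on `Bool` with success probability `p` (meant for `0 ≤ p ≤ 1`). -/
def bernoulliLaw (p : ℝ) : Measure Bool :=
  bernoulliMeasure true false (Set.projIcc (0 : ℝ) 1 zero_le_one p)

/-- The divergence `kl(p ‖ q)` between Bernoulli distributions, with values in `[0, ∞]`. -/
def klBernoulli (p q : ℝ) : ℝ≥0∞ :=
  klDiv (bernoulliLaw p) (bernoulliLaw q)

/-- The density at `x` of the Beta distribution with parameters `a, b`, by its usual formula on the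
closed unit interval. The end points matter here, e.g. the value at `0` for `a = 1` is `b`
(`ProbabilityTheory.betaPDFReal` is set to `0` at both end points; the two agree elsewhere). -/
def betaDensity (x a b : ℝ) : ℝ :=
  if 0 ≤ x ∧ x ≤ 1 then x ^ (a - 1) * (1 - x) ^ (b - 1) / ProbabilityTheory.beta a b else 0

/-- `k = ⌊(N+1) α⌋`. -/
def kIndex (N : ℕ) (α : ℝ) : ℕ := ⌊((N : ℝ) + 1) * α⌋₊

/-- The ratio `(k - 1) / (N - 1)`, computed in the reals. -/
def ratio (N : ℕ) (α : ℝ) : ℝ := ((kIndex N α : ℝ) - 1) / ((N : ℝ) - 1)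

/-- `B(N) = Beta((k - 1) / (N - 1); k, N + 1 - k)`. -/
def coverageB (N : ℕ) (α : ℝ) : ℝ :=
  betaDensity (ratio N α) (kIndex N α : ℝ) ((N : ℝ) + 1 - (kIndex N α : ℝ))

end

end PACBayesICP

namespace PACBayesICP

/-! Write n = N - 1, j = k - 1, r = j/n. The threshold is one of the N scores, with j of the other n
scores above it and n - j below. For an atomless score the miscoverage U therefore behaves like a
Beta(k, N + 1 - k) variable, with density N * choose(n, j) * u^j (1 - u)^(n - j). The likelihood
ratio r^j (1 - r)^(n - j) / (U^j (1 - U)^(n - j)) equals exp(n kl(r ‖ U)). In its expectation the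
Beta density cancels the denominator, leaving exactly B(N) as a bound
(`lintegral_div_miscoverage_le`).

The prior does not depend on the data, so Tonelli gives the same bound for the ratio averaged over
P, and Markov makes this average at most B(N)/δ on one event that serves all Q. On that event
Donsker–Varadhan passes from P to Q. Jensen's inequality is built in by replacing log(u^j (1 - u)^(n
- j)) with its tangent at the Q-mean of u: the exponent becomes bounded and has Q-mean zero
(`log_le_klDiv_add_log`).

For the growth of B(N), note that B(N) = N * `binomialPeak n j` and apply Stirling. -/

/-! ### Order statistics -/

lemma exists_isLeast_empiricalQuantile {N : ℕ} (v : Fin N → ℝ) {m : ℕ} (hm : 0 < m) (hmN : m ≤ N) :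
    ∃ i, empiricalQuantile v ((m : ℝ) / N) = v i ∧
      IsLeast {t : ℝ | m ≤ (Finset.univ.filter (fun l => v l ≤ t)).card} (v i) ∧
      (Finset.univ.filter (fun l => v l < v i)).card < m := by
  have hN : (0 : ℝ) < N := by exact_mod_cast hm.trans_le hmN
  set A : Set ℝ := {t : ℝ | m ≤ (Finset.univ.filter (fun l => v l ≤ t)).card} with hA
  have hset : {t : ℝ | (m : ℝ) / N ≤ ((Finset.univ.filter (fun l => v l ≤ t)).card : ℝ) / N} = A := by
    ext t
    simp only [Set.mem_ofPred_eq, hA]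
    rw [div_le_div_iff_of_pos_right hN, Nat.cast_le]
  have hmax : ∀ t, (∃ l, v l ≤ t) → ∃ l, v l ≤ t ∧ ∀ l', v l' ≤ t → v l' ≤ v l := by
    rintro t ⟨l, hl⟩
    obtain ⟨a, ha, ha'⟩ := Finset.exists_max_image (Finset.univ.filter (fun l => v l ≤ t)) v
      ⟨l, by simpa using hl⟩
    exact ⟨a, by simpa using ha, fun l' hl' => ha' l' (by simpa using hl')⟩
  have hdown : ∀ t ∈ A, ∃ l, v l ∈ A ∧ v l ≤ t := by
    intro t ht
    have : (Finset.univ.filter (fun l => v l ≤ t)).Nonempty := by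
      rw [← Finset.card_pos]; exact hm.trans_le ht
    obtain ⟨l, hl⟩ := this
    obtain ⟨a, ha, ha'⟩ := hmax t ⟨l, by simpa using hl⟩
    refine ⟨a, le_trans (show m ≤ _ from ht) (Finset.card_le_card fun l' hl' => ?_), ha⟩
    simp only [Finset.mem_filter, Finset.mem_univ, true_and] at hl' ⊢
    exact ha' l' hl'
  have hne : ∃ l, v l ∈ A := by
    have : Nonempty (Fin N) := ⟨⟨0, hm.trans_le hmN⟩⟩
    obtain ⟨a, -, ha⟩ := Finset.exists_max_image (Finset.univ : Finset (Fin N)) v Finset.univ_nonempty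
    refine ⟨a, ?_⟩
    simp only [hA, Set.mem_ofPred_eq]
    rw [Finset.filter_true_of_mem (fun l hl => ha l hl)]
    simpa using hmN
  obtain ⟨l, hl⟩ := hne
  obtain ⟨i, hi, hi'⟩ := Finset.exists_min_image
    ((Set.toFinite {l | v l ∈ A}).toFinset) v ⟨l, by simpa using hl⟩
  have hleast : IsLeast A (v i) := by
    refine ⟨by simpa using hi, fun t ht => ?_⟩
    obtain ⟨a, ha, hat⟩ := hdown t ht
    exact (hi' a (by simpa using ha)).trans hat
  refine ⟨i, ?_, hleast, ?_⟩
  · rw [empiricalQuantile, hset]; exact hleast.csInf_eq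
  -- Otherwise the largest value strictly below v i would already qualify, against minimality.
  · by_contra! hcon
    have : (Finset.univ.filter (fun l => v l < v i)).Nonempty := by
      rw [← Finset.card_pos]; omega
    obtain ⟨a, ha, ha'⟩ := Finset.exists_max_image _ v this
    have hamem : v a ∈ A := by
      refine hcon.trans (Finset.card_le_card fun l' hl' => ?_)
      simp only [Finset.mem_filter, Finset.mem_univ, true_and]
      exact ha' l' hl'
    have := hleast.2 hamem
    simp only [Finset.mem_filter, Finset.mem_univ, true_and] at ha
    linarith

lemma empiricalQuantile_le_iff {N : ℕ} (v : Fin N → ℝ) {m : ℕ} (hm : 0 < m) (hmN : m ≤ N) (t : ℝ) :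
    empiricalQuantile v ((m : ℝ) / N) ≤ t ↔
      m ≤ (Finset.univ.filter (fun l => v l ≤ t)).card := by
  obtain ⟨i, hi, hleast, -⟩ := exists_isLeast_empiricalQuantile v hm hmN
  rw [hi]
  refine ⟨fun h => le_trans (show m ≤ _ from hleast.1) (Finset.card_le_card fun l hl => ?_),
    fun h => hleast.2 h⟩
  simp only [Finset.mem_filter, Finset.mem_univ, true_and] at hl ⊢
  exact hl.trans h

lemma measurable_empiricalQuantile {A : Type*} [MeasurableSpace A] {N : ℕ} {v : A → Fin N → ℝ}
    (hv : ∀ i, Measurable fun a => v a i) {m : ℕ} (hm : 0 < m) (hmN : m ≤ N) :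
    Measurable fun a => empiricalQuantile (v a) ((m : ℝ) / N) := by
  refine measurable_of_Iic fun t => ?_
  have : (fun a => empiricalQuantile (v a) ((m : ℝ) / N)) ⁻¹' Set.Iic t =
      {a | (m : ℝ) ≤ ∑ l, ({a | v a l ≤ t}.indicator 1 a : ℝ)} := by
    ext a
    simp only [Set.mem_preimage, Set.mem_Iic, Set.mem_ofPred_eq]
    rw [empiricalQuantile_le_iff _ hm hmN, Finset.card_filter, ← Nat.cast_le (α := ℝ)]
    simp [Set.indicator_apply]
  rw [this]
  refine measurableSet_le measurable_const (Finset.measurable_sum _ fun l _ => ?_)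
  exact measurable_one.indicator (measurableSet_le (hv l) measurable_const)

/-- The threshold is one of the values, and the other values split into `j` that are at least as
large and `n - j` that are at most as large. -/
lemma exists_split_empiricalQuantile {n j : ℕ} (hj : j ≤ n) (v : Fin (n + 1) → ℝ) :
    ∃ i, ∃ S ∈ Finset.powersetCard j (Finset.univ : Finset (Fin n)),
      empiricalQuantile v (((n + 1 - j : ℕ) : ℝ) / (n + 1 : ℕ)) = v i ∧
      ∀ l, if l ∈ S then v i ≤ v (i.succAbove l) else v (i.succAbove l) ≤ v i := by
  obtain ⟨i, hi, hleast, hlt⟩ := exists_isLeast_empiricalQuantile v (m := n + 1 - j)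
    (by omega) (by omega)
  have h1 : n + 1 - j ≤ (Finset.univ.filter (fun l => v l ≤ v i)).card := hleast.1
  have e1 := Finset.card_filter_add_card_filter_not (s := (Finset.univ : Finset (Fin (n + 1)))) (fun l => v l ≤ v i)
  have e2 := Finset.card_filter_add_card_filter_not (s := (Finset.univ : Finset (Fin (n + 1)))) (fun l => v l < v i)
  simp only [not_le, not_lt, Finset.card_univ, Fintype.card_fin] at e1 e2
  have e3 : (Finset.univ.filter (fun l => v i < v (i.succAbove l))).card =
      (Finset.univ.filter (fun l => v i < v l)).card := by
    simp only [Finset.card_filter]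
    rw [Fin.sum_univ_succAbove _ i]; simp
  have e4 : (Finset.univ.filter (fun l => v i ≤ v (i.succAbove l))).card + 1 =
      (Finset.univ.filter (fun l => v i ≤ v l)).card := by
    simp only [Finset.card_filter]
    rw [Fin.sum_univ_succAbove _ i]; simp [add_comm]
  -- At most j values lie strictly above v i and at least j others lie weakly above, so ties can be
  -- distributed to make S of size exactly j.
  obtain ⟨S, hS1, hS2, hSc⟩ := Finset.exists_subsuperset_card_eq
    (s := Finset.univ.filter (fun l => v i < v (i.succAbove l)))
    (t := Finset.univ.filter (fun l => v i ≤ v (i.succAbove l))) (n := j)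
    (fun l hl => by
      simp only [Finset.mem_filter, Finset.mem_univ, true_and] at hl ⊢; exact hl.le)
    (by omega) (by omega)
  refine ⟨i, S, by simp [Finset.mem_powersetCard, hSc], hi, fun l => ?_⟩
  split_ifs with hl
  · simpa using hS2 hl
  · by_contra! hc
    exact hl (hS1 (by simpa using hc))

/-- Sum over which sample is the threshold and which j others lie above it; Fubini factors each
term. Ties make these events overlap, which costs nothing for an upper bound and spares computing
the law of the order statistic. -/
lemma lintegral_empiricalQuantile_le {Z : Type*} [MeasurableSpace Z] (D : Measure Z)
    [IsProbabilityMeasure D] {f : Z → ℝ} (hf : Measurable f) (hat : ∀ t, D {z | f z = t} = 0)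
    {n j : ℕ} (hj : j ≤ n) {g : ℝ → ℝ≥0∞} (hg : Measurable g) :
    ∫⁻ d, g (empiricalQuantile (fun i => f (d i)) (((n + 1 - j : ℕ) : ℝ) / (n + 1 : ℕ)))
        ∂(Measure.pi fun _ : Fin (n + 1) => D) ≤
      ((n + 1) * n.choose j : ℕ) *
        ∫⁻ z, g (f z) * (D {w | f z < f w} ^ j * (1 - D {w | f z < f w}) ^ (n - j)) ∂D := by
  let T : Fin (n + 1) → Finset (Fin n) → Set (Fin (n + 1) → Z) := fun i S =>
    {d | ∀ l, if l ∈ S then f (d i) ≤ f (d (i.succAbove l)) else f (d (i.succAbove l)) ≤ f (d i)}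
  let T' : Finset (Fin n) → Set (Z × (Fin n → Z)) := fun S =>
    {p | ∀ l, if l ∈ S then f p.1 ≤ f (p.2 l) else f (p.2 l) ≤ f p.1}
  have hT' : ∀ S, MeasurableSet (T' S) := by
    intro S
    simp only [T', Set.ofPred_forall]
    refine MeasurableSet.iInter fun l => ?_
    split_ifs
    · exact measurableSet_le (by fun_prop) (by fun_prop)
    · exact measurableSet_le (by fun_prop) (by fun_prop)
  have hTT : ∀ i S, T i S = MeasurableEquiv.piFinSuccAbove (fun _ => Z) i ⁻¹' T' S := by
    intro i S; ext d
    simp [T, T', MeasurableEquiv.piFinSuccAbove, Fin.insertNthEquiv, Fin.removeNth]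
  have hT : ∀ i S, MeasurableSet (T i S) := by
    intro i S; rw [hTT]; exact (MeasurableEquiv.measurable _) (hT' S)
  have hpt : ∀ d : Fin (n + 1) → Z,
      g (empiricalQuantile (fun i => f (d i)) (((n + 1 - j : ℕ) : ℝ) / (n + 1 : ℕ))) ≤
        ∑ i, ∑ S ∈ Finset.powersetCard j (Finset.univ : Finset (Fin n)),
          (T i S).indicator (fun d => g (f (d i))) d := by
    intro d
    obtain ⟨i, S, hS, hi, hl⟩ := exists_split_empiricalQuantile hj (fun i => f (d i))
    rw [hi]
    refine le_trans ?_ (Finset.single_le_sum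
      (f := fun i => ∑ S ∈ Finset.powersetCard j (Finset.univ : Finset (Fin n)),
          (T i S).indicator (fun d => g (f (d i))) d) (fun _ _ => zero_le) (Finset.mem_univ i))
    refine le_trans ?_ (Finset.single_le_sum
      (f := fun S => (T i S).indicator (fun d => g (f (d i))) d) (fun _ _ => zero_le) hS)
    rw [Set.indicator_of_mem (show d ∈ T i S from hl)]
  have hterm : ∀ i, ∀ S ∈ Finset.powersetCard j (Finset.univ : Finset (Fin n)),
      ∫⁻ d, (T i S).indicator (fun d => g (f (d i))) d ∂(Measure.pi fun _ : Fin (n + 1) => D) =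
        ∫⁻ z, g (f z) * (D {w | f z < f w} ^ j * (1 - D {w | f z < f w}) ^ (n - j)) ∂D := by
    intro i S hS
    have hgm : Measurable fun p : Z × (Fin n → Z) => (T' S).indicator (fun p => g (f p.1)) p :=
      (hg.comp (hf.comp measurable_fst)).indicator (hT' S)
    have hmp := (measurePreserving_piFinSuccAbove (fun _ : Fin (n + 1) => D) i).lintegral_comp hgm
    have : ∀ d : Fin (n + 1) → Z, (T i S).indicator (fun d => g (f (d i))) d =
        (T' S).indicator (fun p => g (f p.1)) (MeasurableEquiv.piFinSuccAbove (fun _ => Z) i d) := by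
      intro d
      rw [hTT]
      exact Set.indicator_comp_right
        (MeasurableEquiv.piFinSuccAbove (fun _ : Fin (n + 1) => Z) i) (s := T' S)
        (g := fun p => g (f p.1))
    simp_rw [this]
    rw [hmp, lintegral_prod _ hgm.aemeasurable]
    refine lintegral_congr fun z => ?_
    have hsec : ∀ y : Fin n → Z, (T' S).indicator (fun p => g (f p.1)) (z, y) =
        (Set.pi Set.univ fun l => if l ∈ S then {w | f z ≤ f w} else {w | f w ≤ f z}).indicator
          (fun _ => g (f z)) y := by
      intro y
      have : (z, y) ∈ T' S ↔ y ∈ Set.pi Set.univ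
          (fun l => if l ∈ S then {w | f z ≤ f w} else {w | f w ≤ f z}) := by
        simp only [T', Set.mem_ofPred_eq, Set.mem_pi, Set.mem_univ, true_imp_iff]
        refine forall_congr' fun l => ?_
        split_ifs <;> rfl
      by_cases h : (z, y) ∈ T' S
      · rw [Set.indicator_of_mem h, Set.indicator_of_mem (this.1 h)]
      · rw [Set.indicator_of_notMem h, Set.indicator_of_notMem (fun h' => h (this.2 h'))]
    simp_rw [hsec]
    rw [lintegral_indicator_const]
    · congr 1
      rw [Measure.pi_pi]
      -- The absence of atoms enters only here.
      have hge : D {w | f z ≤ f w} = D {w | f z < f w} := by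
        refine le_antisymm ?_ (measure_mono fun w (hw : f z < f w) => hw.le)
        calc D {w | f z ≤ f w} ≤ D ({w | f z < f w} ∪ {w | f w = f z}) :=
              measure_mono fun w hw => (lt_or_eq_of_le (show f z ≤ f w from hw)).imp id Eq.symm
          _ ≤ _ := (measure_union_le _ _).trans (by rw [hat, add_zero])
      have hle : D {w | f w ≤ f z} = 1 - D {w | f z < f w} := by
        rw [← prob_compl_eq_one_sub (measurableSet_lt measurable_const hf)]
        congr 1; ext w; simp
      have : ∀ l, D (if l ∈ S then {w | f z ≤ f w} else {w | f w ≤ f z}) =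
          if l ∈ S then D {w | f z < f w} else 1 - D {w | f z < f w} := by
        intro l; split_ifs
        · exact hge
        · exact hle
      simp_rw [this]
      rw [Finset.prod_ite, Finset.prod_const, Finset.prod_const]
      obtain ⟨-, hc⟩ := Finset.mem_powersetCard.1 hS
      have e1 : (Finset.univ.filter (fun l => l ∈ S)) = S := by ext; simp
      have e2 : (Finset.univ.filter (fun l => l ∉ S)) = Sᶜ := by ext; simp
      rw [e1, e2, Finset.card_compl, hc, Fintype.card_fin]
    · refine MeasurableSet.univ_pi fun l => ?_
      split_ifs
      · exact measurableSet_le measurable_const hf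
      · exact measurableSet_le hf measurable_const
  calc _ ≤ ∫⁻ d, ∑ i, ∑ S ∈ Finset.powersetCard j (Finset.univ : Finset (Fin n)),
          (T i S).indicator (fun d => g (f (d i))) d ∂(Measure.pi fun _ : Fin (n + 1) => D) :=
        lintegral_mono hpt
    _ = ∑ i, ∑ S ∈ Finset.powersetCard j (Finset.univ : Finset (Fin n)),
          ∫⁻ d, (T i S).indicator (fun d => g (f (d i))) d ∂(Measure.pi fun _ : Fin (n + 1) => D) := by
        have hm : ∀ i S, Measurable fun d => (T i S).indicator (fun d => g (f (d i))) d :=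
          fun i S => (hg.comp (hf.comp (measurable_pi_apply i))).indicator (hT i S)
        rw [lintegral_finsetSum _ fun i _ => Finset.measurable_sum _ fun S _ => hm i S]
        exact Finset.sum_congr rfl fun i _ => lintegral_finsetSum _ fun S _ => hm i S
    _ = _ := by
        rw [Finset.sum_congr rfl fun i _ => Finset.sum_congr rfl fun S hS => hterm i S hS]
        simp [Finset.card_powersetCard, mul_assoc]

/-! ### Divergence of Bernoulli laws -/

lemma bernoulliLaw_eq (p : ℝ) (h0 : 0 ≤ p) (h1 : p ≤ 1) :
    bernoulliLaw p = ENNReal.ofReal p • Measure.dirac true +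
      ENNReal.ofReal (1 - p) • Measure.dirac false := by
  rw [bernoulliLaw, Set.projIcc_of_mem zero_le_one ⟨h0, h1⟩, bernoulliMeasure_def,
    ENNReal.ofReal_eq_coe_nnreal h0, ENNReal.ofReal_eq_coe_nnreal (sub_nonneg.2 h1)]
  rfl

/-- The last two hypotheses are absolute continuity; they make the value 0 of a division by zero
harmless. -/
lemma bernoulliLaw_eq_withDensity {r q : ℝ} (hr : r ∈ Set.Icc (0 : ℝ) 1)
    (hq : q ∈ Set.Icc (0 : ℝ) 1) (h0 : q = 0 → r = 0) (h1 : q = 1 → r = 1) :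
    bernoulliLaw r = (bernoulliLaw q).withDensity
      fun b => ENNReal.ofReal (if b then r / q else (1 - r) / (1 - q)) := by
  have hq1 : 0 ≤ 1 - q := sub_nonneg.2 hq.2
  rw [bernoulliLaw_eq r hr.1 hr.2, bernoulliLaw_eq q hq.1 hq.2]
  refine Measure.ext_of_singleton fun b => ?_
  rw [withDensity_apply _ (measurableSet_singleton b), lintegral_singleton]
  cases b
  · simp only [Bool.false_eq_true, if_false, Measure.add_apply, Measure.smul_apply,
      Measure.dirac_apply, smul_eq_mul]
    simp only [Set.indicator_apply, Set.mem_singleton_iff]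
    simp only [reduceCtorEq, if_false, if_true, mul_zero, zero_add, Pi.one_apply, mul_one]
    rw [← ENNReal.ofReal_mul (div_nonneg (sub_nonneg.2 hr.2) hq1)]
    congr 1
    rcases eq_or_ne q 1 with h | h
    · simp [h, h1 h]
    · rw [div_mul_cancel₀ _ (sub_ne_zero.2 h.symm)]
  · simp only [if_true, Measure.add_apply, Measure.smul_apply,
      Measure.dirac_apply, smul_eq_mul]
    simp only [Set.indicator_apply, Set.mem_singleton_iff]
    simp only [reduceCtorEq, if_false, if_true, mul_zero, add_zero, Pi.one_apply, mul_one]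
    rw [← ENNReal.ofReal_mul (div_nonneg hr.1 hq.1)]
    congr 1
    rcases eq_or_ne q 0 with h | h
    · simp [h, h0 h]
    · rw [div_mul_cancel₀ _ h]

instance (p : ℝ) : IsProbabilityMeasure (bernoulliLaw p) := by
  unfold bernoulliLaw; infer_instance

lemma klBernoulli_eq {r q : ℝ} (hr : r ∈ Set.Icc (0 : ℝ) 1)
    (hq : q ∈ Set.Icc (0 : ℝ) 1) (h0 : q = 0 → r = 0) (h1 : q = 1 → r = 1) :
    0 ≤ r * Real.log (r / q) + (1 - r) * Real.log ((1 - r) / (1 - q)) ∧ klBernoulli r q =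
      ENNReal.ofReal (r * Real.log (r / q) + (1 - r) * Real.log ((1 - r) / (1 - q))) := by
  have hq1 : 0 ≤ 1 - q := sub_nonneg.2 hq.2
  have hd := bernoulliLaw_eq_withDensity hr hq h0 h1
  have hac : bernoulliLaw r ≪ bernoulliLaw q := by
    rw [hd]; exact withDensity_absolutelyContinuous _ _
  have hrn : (bernoulliLaw r).rnDeriv (bernoulliLaw q) =ᵐ[bernoulliLaw q]
      fun b => ENNReal.ofReal (if b then r / q else (1 - r) / (1 - q)) := by
    have := Measure.rnDeriv_withDensity (bernoulliLaw q)
      (f := fun b => ENNReal.ofReal (if b then r / q else (1 - r) / (1 - q))) (by fun_prop)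
    rwa [← hd] at this
  rw [klBernoulli, klDiv_eq_lintegral_klFun_of_ac hac]
  have : ∫⁻ b, ENNReal.ofReal (klFun ((bernoulliLaw r).rnDeriv (bernoulliLaw q) b).toReal)
        ∂(bernoulliLaw q) =
      ∫⁻ b, ENNReal.ofReal (klFun (if b then r / q else (1 - r) / (1 - q))) ∂(bernoulliLaw q) := by
    refine lintegral_congr_ae (hrn.mono fun b hb => ?_)
    simp only
    rw [hb, ENNReal.toReal_ofReal]
    split_ifs
    · exact div_nonneg hr.1 hq.1
    · exact div_nonneg (sub_nonneg.2 hr.2) hq1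
  rw [this, bernoulliLaw_eq q hq.1 hq.2, lintegral_add_measure, lintegral_smul_measure,
    lintegral_smul_measure, lintegral_dirac, lintegral_dirac]
  simp only [if_true, Bool.false_eq_true, if_false, smul_eq_mul]
  have k1 := klFun_nonneg (div_nonneg hr.1 hq.1)
  have k2 := klFun_nonneg (div_nonneg (sub_nonneg.2 hr.2) hq1)
  rw [← ENNReal.ofReal_mul hq.1, ← ENNReal.ofReal_mul hq1,
    ← ENNReal.ofReal_add (mul_nonneg hq.1 k1) (mul_nonneg hq1 k2)]
  have a1 : q * (r / q) = r := by
    rcases eq_or_ne q 0 with h | h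
    · simp [h, h0 h]
    · field_simp
  have a2 : (1 - q) * ((1 - r) / (1 - q)) = 1 - r := by
    rcases eq_or_ne q 1 with h | h
    · simp [h, h1 h]
    · rw [mul_div_cancel₀ _ (sub_ne_zero.2 h.symm)]
  have hsum : q * klFun (r / q) + (1 - q) * klFun ((1 - r) / (1 - q)) =
      r * Real.log (r / q) + (1 - r) * Real.log ((1 - r) / (1 - q)) := by
    simp only [klFun]
    linear_combination (Real.log (r / q) - 1) * a1 + (Real.log ((1 - r) / (1 - q)) - 1) * a2
  rw [← hsum]
  exact ⟨add_nonneg (mul_nonneg hq.1 k1) (mul_nonneg hq1 k2), rfl⟩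

/-! ### Change of measure and Markov's inequality -/

/-- The Donsker–Varadhan inequality for bounded measurable functions. -/
lemma integral_le_klDiv_add_log {Θ : Type*} [MeasurableSpace Θ] {P Q : Measure Θ}
    [IsProbabilityMeasure P] [IsProbabilityMeasure Q] (hQ : klDiv Q P ≠ ∞) {g : Θ → ℝ}
    (hg : Measurable g) {K : ℝ} (hK : ∀ θ, |g θ| ≤ K) :
    ∫ θ, g θ ∂Q ≤ (klDiv Q P).toReal + Real.log (∫ θ, Real.exp (g θ) ∂P) := by
  obtain ⟨hac, hint⟩ := klDiv_ne_top_iff.1 hQ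
  have hgQ : Integrable g Q := Integrable.of_bound hg.aestronglyMeasurable K (.of_forall hK)
  have hgP : Integrable (fun θ => Real.exp (g θ)) P := by
    refine Integrable.of_bound (by fun_prop) (Real.exp K) (.of_forall fun θ => ?_)
    rw [Real.norm_eq_abs, abs_of_pos (Real.exp_pos _)]
    exact Real.exp_le_exp.2 ((le_abs_self _).trans (hK θ))
  have := isProbabilityMeasure_tilted hgP
  have h1 := integral_llr_tilted_right hac hgQ hgP hint
  have hac' : Q ≪ P.tilted g := hac.trans (absolutelyContinuous_tilted hgP)
  have h2 := toReal_klDiv_of_measure_eq hac' (by simp)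
  have h3 := toReal_klDiv_of_measure_eq hac (by simp)
  have h4 : 0 ≤ (klDiv Q (P.tilted g)).toReal := ENNReal.toReal_nonneg
  linarith

/-- Tangent-line bound for the log-concave function `q ↦ q ^ a * (1 - q) ^ b`. -/
lemma pow_mul_pow_le_mul_exp {a b : ℕ} {q p : ℝ} (hq : q ∈ Set.Icc (0 : ℝ) 1)
    (hp : p ∈ Set.Icc (0 : ℝ) 1) (ha : p = 0 → a = 0) (hb : p = 1 → b = 0) :
    q ^ a * (1 - q) ^ b ≤
      p ^ a * (1 - p) ^ b * Real.exp ((a / p - b / (1 - p)) * (q - p)) := by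
  have key : ∀ (a : ℕ) (x y : ℝ), 0 ≤ x → 0 ≤ y → (y = 0 → a = 0) →
      x ^ a ≤ y ^ a * Real.exp (a / y * (x - y)) := by
    intro a x y hx hy h
    rcases hy.eq_or_lt with h0 | h0
    · simp [h h0.symm]
    · have h1 : x ≤ y * Real.exp ((x - y) / y) := by
        have := Real.add_one_le_exp ((x - y) / y)
        calc x = y * ((x - y) / y + 1) := by field_simp; ring
          _ ≤ _ := by gcongr
      calc x ^ a ≤ (y * Real.exp ((x - y) / y)) ^ a := by gcongr
        _ = _ := by rw [mul_pow, ← Real.exp_nat_mul]; congr 2; ring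
  have h1 := key a q p hq.1 hp.1 ha
  have h2 := key b (1 - q) (1 - p) (sub_nonneg.2 hq.2) (sub_nonneg.2 hp.2)
    (fun h => hb (by linarith))
  calc q ^ a * (1 - q) ^ b ≤ (p ^ a * Real.exp (a / p * (q - p))) *
        ((1 - p) ^ b * Real.exp (b / (1 - p) * ((1 - q) - (1 - p)))) :=
        mul_le_mul h1 h2 (pow_nonneg (sub_nonneg.2 hq.2) _)
          (mul_nonneg (pow_nonneg hp.1 _) (Real.exp_pos _).le)
    _ = _ := by
        rw [mul_mul_mul_comm, ← Real.exp_add]; congr 2; ring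

/-- The change of measure step: an exponential moment bound under the prior gives a logarithmic
bound at the posterior mean. -/
lemma log_le_klDiv_add_log {Θ : Type*} [MeasurableSpace Θ] {P Q : Measure Θ}
    [IsProbabilityMeasure P] [IsProbabilityMeasure Q] (hQ : klDiv Q P ≠ ∞) {u : Θ → ℝ}
    (hu : Measurable u) (hu01 : ∀ θ, u θ ∈ Set.Icc (0 : ℝ) 1) {a b : ℕ} {c M : ℝ}
    (hc : 0 < c) (hM : 0 < M)
    (hP : ∫⁻ θ, ENNReal.ofReal c / ENNReal.ofReal (u θ ^ a * (1 - u θ) ^ b) ∂P ≤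
      ENNReal.ofReal M) :
    (∫ θ, u θ ∂Q) ∈ Set.Icc (0 : ℝ) 1 ∧ (∫ θ, u θ ∂Q = 0 → a = 0) ∧ (∫ θ, u θ ∂Q = 1 → b = 0) ∧
      Real.log (c / ((∫ θ, u θ ∂Q) ^ a * (1 - ∫ θ, u θ ∂Q) ^ b)) ≤
        (klDiv Q P).toReal + Real.log M := by
  obtain ⟨hac, -⟩ := klDiv_ne_top_iff.1 hQ
  have huQ : Integrable u Q := Integrable.of_bound hu.aestronglyMeasurable 1
    (.of_forall fun θ => by rw [Real.norm_eq_abs, abs_of_nonneg (hu01 θ).1]; exact (hu01 θ).2)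
  set p := ∫ θ, u θ ∂Q with hp
  have hp0 : 0 ≤ p := integral_nonneg fun θ => (hu01 θ).1
  have hp1' : ∫ θ, (1 - u θ) ∂Q = 1 - p := by
    rw [integral_sub (integrable_const _) huQ]; simp [hp]
  have hp1 : p ≤ 1 := by
    have : 0 ≤ ∫ θ, (1 - u θ) ∂Q := integral_nonneg fun θ => sub_nonneg.2 (hu01 θ).2
    linarith
  have hmeas : Measurable fun θ => ENNReal.ofReal c / ENNReal.ofReal (u θ ^ a * (1 - u θ) ^ b) := by
    fun_prop
  -- A finite prior moment excludes zeros of the denominator P-a.e., hence Q-a.e.; this rules out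
  -- the degenerate means 0 and 1 unless the matching exponent vanishes.
  have hfin : ∀ᵐ θ ∂Q, u θ ^ a * (1 - u θ) ^ b ≠ 0 := by
    refine hac.ae_le ((ae_lt_top hmeas (hP.trans_lt ENNReal.ofReal_lt_top).ne).mono fun θ hθ h => ?_)
    rw [h, ENNReal.ofReal_zero, ENNReal.div_zero (by simpa using hc)] at hθ
    exact lt_irrefl _ hθ
  have ha : p = 0 → a = 0 := by
    intro h
    by_contra h'
    have h0 := (integral_eq_zero_iff_of_nonneg (fun θ => (hu01 θ).1) huQ).1 h
    obtain ⟨θ, h1, h2⟩ := (h0.and hfin).exists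
    exact h2 (by simp [show u θ = 0 from h1, h'])
  have hb : p = 1 → b = 0 := by
    intro h
    by_contra h'
    have h0 := (integral_eq_zero_iff_of_nonneg (fun θ => sub_nonneg.2 (hu01 θ).2)
      ((integrable_const _).sub huQ)).1 (by rw [hp1', h, sub_self])
    obtain ⟨θ, h1, h2⟩ := (h0.and hfin).exists
    exact h2 (by simp [show 1 - u θ = 0 from h1, h'])
  refine ⟨⟨hp0, hp1⟩, ha, hb, ?_⟩
  have hpa : 0 < p ^ a := by
    rcases hp0.eq_or_lt with h | h
    · simp [ha h.symm]
    · positivity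
  have hpb : 0 < (1 - p) ^ b := by
    rcases hp1.eq_or_lt with h | h
    · simp [hb h]
    · exact pow_pos (sub_pos.2 h) _
  have hpos := mul_pos hpa hpb
  -- Slope at p of a log q + b log(1 - q); a term with zero denominator has zero numerator.
  set L : ℝ := a / p - b / (1 - p) with hL
  set h := p ^ a * (1 - p) ^ b with hh
  have hK : ∀ θ, |-(L * (u θ - p))| ≤ |L| := by
    intro θ
    rw [abs_neg, abs_mul]
    have : |u θ - p| ≤ 1 := by
      rw [abs_le]; constructor <;> linarith [(hu01 θ).1, (hu01 θ).2]
    nlinarith [abs_nonneg L]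
  have hdv := integral_le_klDiv_add_log hQ (g := fun θ => -(L * (u θ - p))) (by fun_prop) hK
  have hz : ∫ θ, -(L * (u θ - p)) ∂Q = 0 := by
    rw [integral_neg, integral_const_mul, integral_sub huQ (integrable_const _)]
    simp [hp]
  rw [hz] at hdv
  have hbound : ∫ θ, Real.exp (-(L * (u θ - p))) ∂P ≤ M * h / c := by
    have h1 : ∫⁻ θ, ENNReal.ofReal (Real.exp (-(L * (u θ - p)))) ∂P ≤
        ENNReal.ofReal (h / c) * ENNReal.ofReal M := by
      refine le_trans ?_ (mul_le_mul_right hP (ENNReal.ofReal (h / c)))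
      rw [← lintegral_const_mul _ hmeas]
      refine lintegral_mono fun θ => ?_
      have ht := pow_mul_pow_le_mul_exp (a := a) (b := b) (hu01 θ) ⟨hp0, hp1⟩ ha hb
      rw [← mul_div_assoc, ← ENNReal.ofReal_mul (by positivity), div_mul_cancel₀ _ hc.ne']
      refine (ENNReal.le_div_iff_mul_le (.inr (by simpa using hpos)) (.inr ENNReal.ofReal_ne_top)).2 ?_
      rw [← ENNReal.ofReal_mul (Real.exp_pos _).le]
      refine ENNReal.ofReal_le_ofReal ?_
      rw [Real.exp_neg]
      rw [inv_mul_le_iff₀ (Real.exp_pos _), mul_comm (Real.exp _)]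
      exact ht
    rw [integral_eq_lintegral_of_nonneg_ae (.of_forall fun θ => (Real.exp_pos _).le)
      (by fun_prop)]
    refine ENNReal.toReal_le_of_le_ofReal (by positivity) (h1.trans_eq ?_)
    rw [← ENNReal.ofReal_mul (by positivity)]
    congr 1; ring
  have hIpos : 0 < ∫ θ, Real.exp (-(L * (u θ - p))) ∂P := by
    refine integral_exp_pos (Integrable.of_bound (by fun_prop) (Real.exp |L|)
      (.of_forall fun θ => ?_))
    rw [Real.norm_eq_abs, abs_of_pos (Real.exp_pos _)]
    exact Real.exp_le_exp.2 ((le_abs_self _).trans (hK θ))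
  have hlog := Real.log_le_log hIpos hbound
  have : Real.log (M * h / c) = Real.log M - Real.log (c / h) := by
    rw [Real.log_div (by positivity) hc.ne', Real.log_mul hM.ne' hpos.ne',
      Real.log_div hc.ne' hpos.ne']; ring
  linarith

/-- A strict form of Markov's inequality at level `B / δ`. -/
lemma one_sub_lt_measureReal_lintegral_le {A : Type*} [MeasurableSpace A] (μ : Measure A)
    [IsProbabilityMeasure μ] {F : A → ℝ≥0∞} (hF : Measurable F) {B δ : ℝ} (hB : 0 < B)
    (hδ : 0 < δ) (h : ∫⁻ x, F x ∂μ ≤ ENNReal.ofReal B) :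
    1 - δ < μ.real {x | F x ≤ ENNReal.ofReal (B / δ)} := by
  have hm : MeasurableSet {x | F x ≤ ENNReal.ofReal (B / δ)} := measurableSet_le hF measurable_const
  have hc := probReal_add_probReal_compl (μ := μ) hm
  set E := {x | F x ≤ ENNReal.ofReal (B / δ)}
  by_contra! hcon
  have hδE : δ ≤ μ.real Eᶜ := by linarith
  have hpos : μ Eᶜ ≠ 0 := by
    intro h0
    rw [measureReal_def, h0] at hδE
    simp at hδE; linarith
  -- F exceeds B/δ strictly on a set of positive measure, which is what makes the final probability
  -- bound strict.
  have h1 : ∫⁻ _ in Eᶜ, ENNReal.ofReal (B / δ) ∂μ < ∫⁻ x in Eᶜ, F x ∂μ := by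
    refine setLIntegral_strict_mono hm.compl hpos hF ?_ ?_
    · rw [setLIntegral_const]
      exact ENNReal.mul_ne_top ENNReal.ofReal_ne_top (measure_ne_top _ _)
    · exact .of_forall fun x hx => by simpa [E] using hx
  rw [setLIntegral_const] at h1
  have h2 : ENNReal.ofReal B ≤ ENNReal.ofReal (B / δ) * μ Eᶜ := by
    rw [← ENNReal.ofReal_toReal (measure_ne_top μ Eᶜ), ← ENNReal.ofReal_mul (by positivity)]
    refine ENNReal.ofReal_le_ofReal ?_
    rw [div_mul_eq_mul_div, le_div_iff₀ hδ]
    exact mul_le_mul_of_nonneg_left hδE hB.le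
  exact absurd ((h2.trans_lt h1).trans_le ((setLIntegral_le_lintegral _ _).trans h)) (lt_irrefl _)

/-! ### Stirling bounds for the binomial peak -/

/-- The Stirling sequence decreases from its first value e/√2. -/
lemma factorial_le_stirling {n : ℕ} (hn : n ≠ 0) :
    (n.factorial : ℝ) ≤ Real.exp 1 * √n * (n / Real.exp 1) ^ n := by
  obtain ⟨m, rfl⟩ := Nat.exists_eq_succ_of_ne_zero hn
  have h : Stirling.stirlingSeq (m + 1) ≤ Stirling.stirlingSeq 1 :=
    Stirling.stirlingSeq'_antitone (Nat.zero_le m)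
  rw [Stirling.stirlingSeq_one, Stirling.stirlingSeq, div_le_iff₀ (by positivity)] at h
  refine h.trans_eq ?_
  rw [Real.sqrt_mul (by norm_num)]
  field_simp

/-- The binomial probability of the outcome `j` out of `n` at its own frequency `j / n`. -/
noncomputable def binomialPeak (n j : ℕ) : ℝ :=
  n.choose j * ((j / n : ℝ) ^ j * (1 - j / n : ℝ) ^ (n - j))

lemma binomialPeak_nonneg {n j : ℕ} (hj : j ≤ n) : 0 ≤ binomialPeak n j := by
  have h : (j / n : ℝ) ≤ 1 := div_le_one_of_le₀ (by exact_mod_cast hj) (Nat.cast_nonneg _)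
  have := sub_nonneg.2 h
  unfold binomialPeak; positivity

lemma binomialPeak_le_of_pos {a b : ℕ} (ha : a ≠ 0) (hb : b ≠ 0) :
    binomialPeak (a + b) a * (√a * √b) ≤ Real.exp 1 * √(a + b : ℕ) := by
  have ha' : (0 : ℝ) < a := by positivity
  have hb' : (0 : ℝ) < b := by positivity
  have hfac : ((a + b).choose a : ℝ) * (a.factorial * b.factorial) = (a + b).factorial := by
    rw [← mul_assoc, Nat.choose_symm_add]; exact_mod_cast Nat.add_choose_mul_factorial_mul_factorial a b
  have low : ∀ c : ℕ, √c * (c / Real.exp 1) ^ c ≤ (c.factorial : ℝ) := by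
    intro c
    refine le_trans ?_ (Stirling.le_factorial_stirling c)
    gcongr
    have : (0 : ℝ) ≤ c := Nat.cast_nonneg c
    nlinarith [Real.pi_gt_three]
  have hup := factorial_le_stirling (n := a + b) (by omega)
  have h1 : ((a + b).choose a : ℝ) * ((√a * (a / Real.exp 1) ^ a) * (√b * (b / Real.exp 1) ^ b)) ≤
      Real.exp 1 * √(a + b : ℕ) * ((a + b : ℕ) / Real.exp 1) ^ (a + b) := by
    refine le_trans ?_ hup
    rw [← hfac]
    gcongr
    · exact low a
    · exact low b
  have h2 : binomialPeak (a + b) a * (√a * √b) * ((a + b : ℕ) / Real.exp 1) ^ (a + b) =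
      ((a + b).choose a : ℝ) * ((√a * (a / Real.exp 1) ^ a) * (√b * (b / Real.exp 1) ^ b)) := by
    unfold binomialPeak
    have : (1 - a / (a + b : ℕ) : ℝ) = b / (a + b : ℕ) := by
      push_cast; field_simp; ring
    rw [this, Nat.add_sub_cancel_left, pow_add]
    simp only [div_pow]
    field_simp
  rw [← h2] at h1
  exact le_of_mul_le_mul_right h1 (by positivity)

/-- The shifts keep the bound meaningful at j = 0 and j = n, where the peak is 1, and match the
rounding in k. The 6 comes from j + 2 ≤ 3j and b + 1 ≤ 2b for j, b ≥ 1. -/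
lemma sq_binomialPeak_mul_le {n j : ℕ} (hj : j ≤ n) :
    binomialPeak n j ^ 2 * ((j + 2) * (n - j + 1)) ≤ 6 * Real.exp 1 ^ 2 * (n + 1) := by
  have he : 1 ≤ Real.exp 1 ^ 2 := one_le_pow₀ (Real.one_le_exp zero_le_one)
  have hn0 : (0 : ℝ) ≤ n := Nat.cast_nonneg n
  rcases Nat.eq_zero_or_pos j with rfl | hj0
  · simp only [binomialPeak, Nat.choose_zero_right]
    generalize Real.exp 1 ^ 2 = E at he
    simp; nlinarith
  rcases hj.eq_or_lt with rfl | hjn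
  · have : (j : ℝ) ≠ 0 := by positivity
    generalize Real.exp 1 ^ 2 = E at he
    simp [binomialPeak, this]; nlinarith
  obtain ⟨b, rfl⟩ := Nat.exists_eq_add_of_le hj
  have hb : 1 ≤ b := by omega
  have h := binomialPeak_le_of_pos (a := j) (b := b) (by omega) (by omega)
  have h0 := binomialPeak_nonneg hj
  have h2 := pow_le_pow_left₀ (by positivity) h 2
  rw [mul_pow, mul_pow, mul_pow, Real.sq_sqrt (by positivity), Real.sq_sqrt (by positivity),
    Real.sq_sqrt (by positivity)] at h2
  push_cast at h2 ⊢
  have hj1 : (1 : ℝ) ≤ j := by exact_mod_cast hj0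
  have hb1 : (1 : ℝ) ≤ b := by exact_mod_cast hb
  have h3 : ((j : ℝ) + 2) * (j + b - j + 1) ≤ 6 * (j * b) := by nlinarith
  have h4 := mul_le_mul_of_nonneg_left h3 (sq_nonneg (binomialPeak (j + b) j))
  nlinarith

/-! ### The rank k and the constant B(N) -/

/-- The condition on N says (N + 1)α > 1, which gives k ≥ 1; α < 1 gives k ≤ N. -/
lemma kIndex_bounds {N : ℕ} {α : ℝ} (h0 : 0 < α) (h1 : α < 1) (hN : 1 / α - 1 < (N : ℝ)) :
    1 ≤ kIndex N α ∧ kIndex N α ≤ N ∧ ((N : ℝ) + 1) * α < kIndex N α + 1 ∧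
      (kIndex N α : ℝ) ≤ ((N : ℝ) + 1) * α := by
  have hpos : 0 ≤ ((N : ℝ) + 1) * α := by positivity
  have hle : (kIndex N α : ℝ) ≤ ((N : ℝ) + 1) * α := Nat.floor_le hpos
  refine ⟨?_, ?_, Nat.lt_floor_add_one _, hle⟩
  · refine Nat.le_floor ?_
    rw [sub_lt_iff_lt_add, div_lt_iff₀ h0] at hN
    exact_mod_cast hN.le
  · have : (kIndex N α : ℝ) < N + 1 := hle.trans_lt (by
      have : (0 : ℝ) < (N : ℝ) + 1 := by positivity
      nlinarith)
    exact Nat.lt_succ_iff.1 (by exact_mod_cast this)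

lemma threshold_eq {X Y Θ : Type*} (s : X → Y → Θ → ℝ) {N : ℕ} (d : Fin N → X × Y) {α : ℝ}
    (h0 : 0 < α) (h1 : α < 1) (hN : 1 / α - 1 < (N : ℝ)) (θ : Θ) :
    threshold s d α θ =
      empiricalQuantile (fun i => s (d i).1 (d i).2 θ) (((N + 1 - kIndex N α : ℕ) : ℝ) / N) := by
  obtain ⟨hk1, hk2, hlt, hle⟩ := kIndex_bounds h0 h1 hN
  have : ⌈((N : ℝ) + 1) * (1 - α)⌉₊ = N + 1 - kIndex N α := by
    rw [Nat.ceil_eq_iff (by omega), Nat.cast_sub (by omega), Nat.cast_sub (by omega)]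
    push_cast
    constructor <;> linarith
  rw [threshold, this]

lemma coverageB_eq {n j : ℕ} {α : ℝ} (hj : j ≤ n) (hk : kIndex (n + 1) α = j + 1) :
    coverageB (n + 1) α = (n + 1) * binomialPeak n j := by
  have hr : ratio (n + 1) α = j / n := by rw [ratio, hk]; push_cast; simp
  have h01 : (0 : ℝ) ≤ j / n ∧ (j / n : ℝ) ≤ 1 :=
    ⟨by positivity, div_le_one_of_le₀ (by exact_mod_cast hj) (Nat.cast_nonneg _)⟩
  rw [coverageB, hr, hk, betaDensity, if_pos h01, binomialPeak, ProbabilityTheory.beta]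
  have e1 : ((j + 1 : ℕ) : ℝ) - 1 = (j : ℕ) := by push_cast; ring
  have e2 : ((n + 1 : ℕ) : ℝ) + 1 - ((j + 1 : ℕ) : ℝ) = ((n - j : ℕ) : ℝ) + 1 := by
    push_cast [Nat.cast_sub hj]; ring
  have e3 : ((j + 1 : ℕ) : ℝ) + (((n - j : ℕ) : ℝ) + 1) = ((n + 1 : ℕ) : ℝ) + 1 := by
    push_cast [Nat.cast_sub hj]; ring
  rw [e2, e1, e3, add_sub_cancel_right, Real.rpow_natCast, Real.rpow_natCast, Nat.cast_succ j,
    Real.Gamma_nat_eq_factorial, Real.Gamma_nat_eq_factorial, Real.Gamma_nat_eq_factorial,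
    Nat.cast_choose ℝ hj, Nat.factorial_succ]
  have f1 : (j.factorial : ℝ) ≠ 0 := by positivity
  have f2 : ((n - j).factorial : ℝ) ≠ 0 := by positivity
  have f3 : (n.factorial : ℝ) ≠ 0 := by positivity
  push_cast
  field_simp

lemma frequency_pow_pos {n j : ℕ} (hj : j ≤ n) :
    0 < (j / n : ℝ) ^ j * (1 - j / n : ℝ) ^ (n - j) := by
  rcases Nat.eq_zero_or_pos j with rfl | h
  · simp
  rcases hj.eq_or_lt with rfl | h'
  · have : (j : ℝ) ≠ 0 := by positivity
    simp [this]
  · have hn : (0 : ℝ) < n := by exact_mod_cast h.trans h'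
    have : (j / n : ℝ) < 1 := by rw [div_lt_one hn]; exact_mod_cast h'
    have := sub_pos.2 this
    positivity

lemma coverageB_le {n : ℕ} {α : ℝ} (h0 : 0 < α) (h1 : α < 1)
    (hN : 1 / α - 1 < ((n + 1 : ℕ) : ℝ)) :
    coverageB (n + 1) α ≤ √6 * Real.exp 1 * √(((n + 1 : ℕ) : ℝ) / (α * (1 - α))) := by
  obtain ⟨hk1, hk2, hlt, hle⟩ := kIndex_bounds h0 h1 hN
  obtain ⟨j, hk⟩ := Nat.exists_eq_add_of_le' hk1
  have hj : j ≤ n := by omega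
  rw [coverageB_eq hj hk]
  rw [hk] at hlt hle
  push_cast at hlt hle ⊢
  have h1' : 0 < 1 - α := sub_pos.2 h1
  have hjR : (j : ℝ) ≤ n := by exact_mod_cast hj
  have hj0 : (0 : ℝ) ≤ j := Nat.cast_nonneg j
  have hp := sq_binomialPeak_mul_le hj
  set p := binomialPeak n j
  -- Here N + 1 = n + 2, so the floor gives j + 1 ≤ (n + 2)α < j + 2.
  have hαα : ((n : ℝ) + 1) ^ 2 * (α * (1 - α)) ≤ (j + 2) * (n - j + 1) := by
    have a1 : ((n : ℝ) + 1) * α ≤ j + 2 := by linarith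
    have a2 : ((n : ℝ) + 1) * (1 - α) ≤ n - j + 1 := by linarith
    calc ((n : ℝ) + 1) ^ 2 * (α * (1 - α)) = (((n : ℝ) + 1) * α) * (((n : ℝ) + 1) * (1 - α)) := by
          ring
      _ ≤ _ := mul_le_mul a1 a2 (by positivity) (by positivity)
  refine le_of_sq_le_sq ?_ (by positivity)
  rw [mul_pow, mul_pow (√6 * _), mul_pow (√6), Real.sq_sqrt (by norm_num),
    Real.sq_sqrt (by positivity), ← mul_div_assoc, le_div_iff₀ (by positivity)]
  calc ((n : ℝ) + 1) ^ 2 * p ^ 2 * (α * (1 - α))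
      = p ^ 2 * (((n : ℝ) + 1) ^ 2 * (α * (1 - α))) := by ring
    _ ≤ p ^ 2 * ((j + 2) * (n - j + 1)) := by gcongr
    _ ≤ _ := hp

/-- Identifies n kl(r ‖ q) with the log-likelihood ratio, including the boundary cases through 0^0 =
1. -/
lemma natCast_mul_klBernoulli {n j : ℕ} (hn : n ≠ 0) (hj : j ≤ n) {q : ℝ}
    (h0 : q = 0 → j = 0) (h1 : q = 1 → n - j = 0) :
    n * (j / n * Real.log (j / n / q) + (1 - j / n) * Real.log ((1 - j / n) / (1 - q))) =
      Real.log (((j / n : ℝ) ^ j * (1 - j / n : ℝ) ^ (n - j)) /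
        (q ^ j * (1 - q) ^ (n - j))) := by
  have hn' : (n : ℝ) ≠ 0 := by positivity
  have e : (n : ℝ) * (1 - j / n) = ((n - j : ℕ) : ℝ) := by
    rw [Nat.cast_sub hj]; field_simp
  have hne1 : (j / n / q : ℝ) ^ j ≠ 0 := by
    rcases eq_or_ne j 0 with rfl | hj'
    · simp
    · have : q ≠ 0 := fun h => hj' (h0 h)
      positivity
  have hne2 : ((1 - j / n) / (1 - q) : ℝ) ^ (n - j) ≠ 0 := by
    rcases eq_or_ne (n - j) 0 with h | h
    · simp [h]
    · have a1 : 1 - q ≠ 0 := fun h' => h (h1 (by linarith))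
      have a2 : (1 - j / n : ℝ) ≠ 0 := by
        intro h'; rw [h', mul_zero] at e; exact h (by exact_mod_cast e.symm)
      positivity
  rw [mul_add, ← mul_assoc, ← mul_assoc, mul_div_cancel₀ _ hn', e, ← Real.log_pow, ← Real.log_pow,
    ← Real.log_mul hne1 hne2, div_pow, div_pow _ (1 - q), div_mul_div_comm]

/-! ### Moment bound for the miscoverage -/

lemma miscoverage_eq {X Y Θ : Type*} [MeasurableSpace X] [MeasurableSpace Y]
    {D : Measure (X × Y)} {s : X → Y → Θ → ℝ} {N : ℕ} (d : Fin N → X × Y) (α : ℝ) (θ : Θ) :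
    miscoverage D s d α θ = (D {z | threshold s d α θ < s z.1 z.2 θ}).toReal := by
  simp [miscoverage, predictionSet, measureReal_def]

lemma miscoverage_mem_Icc {X Y Θ : Type*} [MeasurableSpace X] [MeasurableSpace Y]
    {D : Measure (X × Y)} [IsProbabilityMeasure D] {s : X → Y → Θ → ℝ} {N : ℕ}
    (d : Fin N → X × Y) (α : ℝ) (θ : Θ) :
    miscoverage D s d α θ ∈ Set.Icc (0 : ℝ) 1 :=
  ⟨measureReal_nonneg, measureReal_le_one⟩

section Miscoverage

variable {X Y Θ : Type*} [MeasurableSpace X] [MeasurableSpace Y] [MeasurableSpace Θ]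
  {D : Measure (X × Y)} [IsProbabilityMeasure D] {s : X → Y → Θ → ℝ}

lemma measurable_tail (hs : Measurable (fun w : (X × Y) × Θ => s w.1.1 w.1.2 w.2)) :
    Measurable fun p : ℝ × Θ => D {z | p.1 < s z.1 z.2 p.2} := by
  have : MeasurableSet {w : (ℝ × Θ) × (X × Y) | w.1.1 < s w.2.1 w.2.2 w.1.2} :=
    measurableSet_lt (by fun_prop)
      (hs.comp (measurable_snd.prodMk (measurable_snd.comp measurable_fst)))
  exact measurable_measure_prodMk_left this

lemma measurable_miscoverage (hs : Measurable (fun w : (X × Y) × Θ => s w.1.1 w.1.2 w.2))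
    {N : ℕ} {α : ℝ} (h0 : 0 < α) (h1 : α < 1) (hN : 1 / α - 1 < (N : ℝ)) :
    Measurable fun p : (Fin N → X × Y) × Θ => miscoverage D s p.1 α p.2 := by
  obtain ⟨hk1, hk2, -, -⟩ := kIndex_bounds h0 h1 hN
  simp_rw [miscoverage_eq]
  have hthr : Measurable fun p : (Fin N → X × Y) × Θ => threshold s p.1 α p.2 := by
    rw [funext fun p : (Fin N → X × Y) × Θ => threshold_eq s p.1 h0 h1 hN p.2]
    refine measurable_empiricalQuantile (fun i => ?_) (by omega) (by omega)
    have hi : Measurable fun p : (Fin N → X × Y) × Θ => (p.1 i, p.2) :=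
      ((measurable_pi_apply i).comp measurable_fst).prodMk measurable_snd
    exact hs.comp hi
  exact ((measurable_tail (D := D) hs).comp (hthr.prodMk measurable_snd)).ennreal_toReal

/-- The expected likelihood ratio of the binomial frequency against the miscoverage is at most
`B(N)`, for a score without atoms. -/
lemma lintegral_div_miscoverage_le (hs : Measurable (fun w : (X × Y) × Θ => s w.1.1 w.1.2 w.2))
    {n j : ℕ} {α : ℝ} (h0 : 0 < α) (h1 : α < 1) (hN : 1 / α - 1 < ((n + 1 : ℕ) : ℝ))
    (hk : kIndex (n + 1) α = j + 1) (hj : j ≤ n) {θ : Θ}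
    (hat : ∀ t, D {z | s z.1 z.2 θ = t} = 0) :
    ∫⁻ d, ENNReal.ofReal ((j / n : ℝ) ^ j * (1 - j / n : ℝ) ^ (n - j)) /
        ENNReal.ofReal (miscoverage D s d α θ ^ j * (1 - miscoverage D s d α θ) ^ (n - j))
        ∂(Measure.pi fun _ : Fin (n + 1) => D) ≤ ENNReal.ofReal (coverageB (n + 1) α) := by
  set c : ℝ := (j / n : ℝ) ^ j * (1 - j / n : ℝ) ^ (n - j) with hc
  have hf : Measurable fun z : X × Y => s z.1 z.2 θ := hs.comp measurable_prodMk_right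
  let U : ℝ → ℝ≥0∞ := fun t => D {z | t < s z.1 z.2 θ}
  have hU : Measurable U := (measurable_tail (D := D) hs).comp measurable_prodMk_right
  let g : ℝ → ℝ≥0∞ := fun t => ENNReal.ofReal c / (U t ^ j * (1 - U t) ^ (n - j))
  have hg : Measurable g := by fun_prop
  have hG : ∀ d : Fin (n + 1) → X × Y, ENNReal.ofReal c /
        ENNReal.ofReal (miscoverage D s d α θ ^ j * (1 - miscoverage D s d α θ) ^ (n - j)) =
      g (empiricalQuantile (fun i => s (d i).1 (d i).2 θ)
        (((n + 1 - j : ℕ) : ℝ) / (n + 1 : ℕ))) := by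
    intro d
    have ht : threshold s d α θ = empiricalQuantile (fun i => s (d i).1 (d i).2 θ)
        (((n + 1 - j : ℕ) : ℝ) / (n + 1 : ℕ)) := by
      rw [threshold_eq s d h0 h1 hN, hk]
      congr 3; omega
    rw [← ht]
    have hm := miscoverage_mem_Icc (D := D) (s := s) d α θ
    have hUeq : ENNReal.ofReal (miscoverage D s d α θ) = U (threshold s d α θ) := by
      rw [miscoverage_eq, ENNReal.ofReal_toReal (measure_ne_top _ _)]
    simp only [g]
    rw [← hUeq, ENNReal.ofReal_mul (pow_nonneg hm.1 _), ENNReal.ofReal_pow hm.1,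
      ENNReal.ofReal_pow (sub_nonneg.2 hm.2), ENNReal.ofReal_sub _ hm.1, ENNReal.ofReal_one]
  simp_rw [hG]
  refine (lintegral_empiricalQuantile_le D hf hat hj hg).trans ?_
  -- Pointwise cancellation x * (c / x) ≤ c, valid also at x = 0.
  have hle : ∫⁻ z, g (s z.1 z.2 θ) * (U (s z.1 z.2 θ) ^ j * (1 - U (s z.1 z.2 θ)) ^ (n - j)) ∂D ≤
      ENNReal.ofReal c := by
    calc _ ≤ ∫⁻ _, ENNReal.ofReal c ∂D := lintegral_mono fun z => by
          rw [mul_comm]; exact ENNReal.mul_div_le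
      _ = _ := by simp
  calc _ ≤ (((n + 1) * n.choose j : ℕ) : ℝ≥0∞) * ENNReal.ofReal c := by gcongr
    _ = _ := by
      rw [coverageB_eq hj hk, binomialPeak, ← ENNReal.ofReal_natCast,
        ← ENNReal.ofReal_mul (Nat.cast_nonneg _)]
      congr 1; push_cast; rw [hc]; ring

lemma lintegral_lintegral_div_miscoverage_le {P : Measure Θ} [IsProbabilityMeasure P]
    (hs : Measurable (fun w : (X × Y) × Θ => s w.1.1 w.1.2 w.2))
    (hcont : ∀ᵐ θ ∂P, ∀ t : ℝ, D {z | s z.1 z.2 θ = t} = 0)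
    {n j : ℕ} {α : ℝ} (h0 : 0 < α) (h1 : α < 1) (hN : 1 / α - 1 < ((n + 1 : ℕ) : ℝ))
    (hk : kIndex (n + 1) α = j + 1) (hj : j ≤ n) :
    ∫⁻ d, ∫⁻ θ, ENNReal.ofReal ((j / n : ℝ) ^ j * (1 - j / n : ℝ) ^ (n - j)) /
        ENNReal.ofReal (miscoverage D s d α θ ^ j * (1 - miscoverage D s d α θ) ^ (n - j)) ∂P
        ∂(Measure.pi fun _ : Fin (n + 1) => D) ≤ ENNReal.ofReal (coverageB (n + 1) α) := by
  have hm := measurable_miscoverage (D := D) hs h0 h1 hN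
  rw [lintegral_lintegral_swap (Measurable.aemeasurable (by fun_prop))]
  calc _ ≤ ∫⁻ _, ENNReal.ofReal (coverageB (n + 1) α) ∂P :=
        lintegral_mono_ae (hcont.mono fun θ hθ => lintegral_div_miscoverage_le hs h0 h1 hN hk hj hθ)
    _ = _ := by simp

end Miscoverage

/-! ### Assembly of the bound -/

/-- The PAC-Bayes bound for a data set on which the prior moment is controlled. -/
lemma klBernoulli_le_of_lintegral_le {Θ : Type*} [MeasurableSpace Θ] {P Q : Measure Θ}
    [IsProbabilityMeasure P] [IsProbabilityMeasure Q] {u : Θ → ℝ}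
    (hu : Measurable u) (hu01 : ∀ θ, u θ ∈ Set.Icc (0 : ℝ) 1) {n j : ℕ} (hn : n ≠ 0) (hj : j ≤ n)
    {M : ℝ} (hM : 0 < M)
    (hP : ∫⁻ θ, ENNReal.ofReal ((j / n : ℝ) ^ j * (1 - j / n : ℝ) ^ (n - j)) /
      ENNReal.ofReal (u θ ^ j * (1 - u θ) ^ (n - j)) ∂P ≤ ENNReal.ofReal M) :
    ((klBernoulli (j / n) (∫ θ, u θ ∂Q) : ℝ≥0∞) : EReal) ≤
      (((klDiv Q P : ℝ≥0∞) : EReal) + ((Real.log M : ℝ) : EReal)) / ((n : ℝ) : EReal) := by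
  have hnR : (0 : ℝ) < n := by positivity
  have hnE : (0 : EReal) < ((n : ℝ) : EReal) := by exact_mod_cast hnR
  by_cases hQ : klDiv Q P = ∞
  · rw [hQ, EReal.coe_ennreal_top, EReal.top_add_coe,
      EReal.top_div_of_pos_ne_top hnE (EReal.coe_ne_top _)]
    exact le_top
  obtain ⟨hp, hp0, hp1, hlog⟩ := log_le_klDiv_add_log hQ hu hu01 (frequency_pow_pos hj) hM hP
  have hr : (j / n : ℝ) ∈ Set.Icc (0 : ℝ) 1 :=
    ⟨by positivity, div_le_one_of_le₀ (by exact_mod_cast hj) hnR.le⟩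
  set p := ∫ θ, u θ ∂Q
  obtain ⟨hV, hkl⟩ := klBernoulli_eq hr hp (fun h => by simp [hp0 h])
    (fun h => by
      have : j = n := by have := hp1 h; omega
      rw [this, div_self hnR.ne'])
  have hmul := natCast_mul_klBernoulli hn hj hp0 hp1
  rw [← hmul] at hlog
  set V : ℝ := j / n * Real.log (j / n / p) + (1 - j / n) * Real.log ((1 - j / n) / (1 - p))
  rw [hkl, EReal.coe_ennreal_ofReal, max_eq_left hV, EReal.le_div_iff_mul_le hnE (EReal.coe_ne_top _),
    ← ENNReal.ofReal_toReal hQ, EReal.coe_ennreal_ofReal, max_eq_left ENNReal.toReal_nonneg]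
  rw [mul_comm] at hlog
  exact_mod_cast hlog

end PACBayesICP

theorem theorem1 {X Y Θ : Type*} [MeasurableSpace X] [MeasurableSpace Y] [MeasurableSpace Θ]
    (D : Measure (X × Y)) [IsProbabilityMeasure D]
    (P : Measure Θ) [IsProbabilityMeasure P]
    (s : X → Y → Θ → ℝ)
    (hs : Measurable (fun w : (X × Y) × Θ => s w.1.1 w.1.2 w.2))
    (hcont : ∀ᵐ θ ∂P, ∀ t : ℝ, D {z | s z.1 z.2 θ = t} = 0) :
    (∀ (N : ℕ) (α δ : ℝ), 2 ≤ N → 0 < α → α < 1 → 1 / α - 1 < (N : ℝ) → 0 < δ →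
      ∃ E : Set (Fin N → X × Y), MeasurableSet E ∧
        1 - δ < (Measure.pi (fun _ : Fin N => D)).real E ∧
        ∀ d ∈ E, ∀ Q : Measure Θ, IsProbabilityMeasure Q →
          ((PACBayesICP.klBernoulli (PACBayesICP.ratio N α)
              (PACBayesICP.randomizedMiscoverage D s d α Q) : ℝ≥0∞) : EReal) ≤
            (((klDiv Q P : ℝ≥0∞) : EReal) +
                ((Real.log (PACBayesICP.coverageB N α / δ) : ℝ) : EReal)) /
              (((N : ℝ) - 1 : ℝ) : EReal)) ∧
    (∃ C : ℝ, 0 < C ∧ ∀ (N : ℕ) (α : ℝ), 2 ≤ N → 0 < α → α < 1 → 1 / α - 1 < (N : ℝ) →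
      PACBayesICP.coverageB N α ≤ C * Real.sqrt ((N : ℝ) / (α * (1 - α)))) := by
  refine ⟨?_, √6 * Real.exp 1, by positivity, ?_⟩
  · intro N α δ hN2 h0 h1 hN hδ
    obtain ⟨n, rfl⟩ := Nat.exists_eq_add_of_le' (show 1 ≤ N by omega)
    obtain ⟨hk1, hk2, -, -⟩ := PACBayesICP.kIndex_bounds h0 h1 hN
    obtain ⟨j, hk⟩ := Nat.exists_eq_add_of_le' hk1
    have hj : j ≤ n := by omega
    have hB : 0 < PACBayesICP.coverageB (n + 1) α := by
      rw [PACBayesICP.coverageB_eq hj hk, PACBayesICP.binomialPeak]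
      have := PACBayesICP.frequency_pow_pos hj
      have : 0 < n.choose j := Nat.choose_pos hj
      positivity
    have hm := PACBayesICP.measurable_miscoverage (D := D) hs h0 h1 hN
    have hF : Measurable fun d : Fin (n + 1) → X × Y =>
        ∫⁻ θ, ENNReal.ofReal ((j / n : ℝ) ^ j * (1 - j / n : ℝ) ^ (n - j)) /
          ENNReal.ofReal (PACBayesICP.miscoverage D s d α θ ^ j *
            (1 - PACBayesICP.miscoverage D s d α θ) ^ (n - j)) ∂P :=
      Measurable.lintegral_prod_right (by fun_prop)
    -- The event is that the prior average is at most B(N)/δ; it does not involve Q, hence the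
    -- uniformity.
    refine ⟨_, measurableSet_le hF measurable_const,
      PACBayesICP.one_sub_lt_measureReal_lintegral_le _ hF hB hδ
        (PACBayesICP.lintegral_lintegral_div_miscoverage_le hs hcont h0 h1 hN hk hj), ?_⟩
    intro d hd Q hQ
    have hr : PACBayesICP.ratio (n + 1) α = j / n := by
      rw [PACBayesICP.ratio, hk]; push_cast; simp
    have hn1 : ((n + 1 : ℕ) : ℝ) - 1 = n := by push_cast; ring
    rw [hr, hn1]
    exact PACBayesICP.klBernoulli_le_of_lintegral_le (hm.comp measurable_prodMk_left)
      (PACBayesICP.miscoverage_mem_Icc d α) (by omega) hj (by positivity) hd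
  · intro N α hN2 h0 h1 hN
    obtain ⟨n, rfl⟩ := Nat.exists_eq_add_of_le' (show 1 ≤ N by omega)
    exact PACBayesICP.coverageB_le h0 h1 hN
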